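/- **Logic.** For a totally ordered Abelian group $(G,*,\le)$ (written multiplicatively, with identity $1_G$) let $\Gamma_G=\{0\}\cup G\cup\{\infty\}$, ordered by extending the order of $G$ with least element $0$ and greatest element $\infty$. Extend the operations of $G$ to $\Gamma_G$ by $\infty*0=0*\infty=1_G$, $a*\infty=\infty*a=\infty$ and $a*0=0*a=0$ for $a\in G$, $\infty*\infty=\infty$, $0*0=0$, $0^{-1}=\infty$, $\infty^{-1}=0$. Let $\tau$ be a first-order language (function and predicate symbols of arbitrary finite arities) with a distinguished binary predicate symbol $e$. Formulas are built from $\bot$, $\bar 1$ and atomic formulas $P(t_1,\dots,t_n)$ with the connectives $\wedge,\to,\otimes,{}^{-1}$ and the quantifiers $\forall,\exists$, over the variables $x_0,x_1,\dots$ A $\tau$-structure $\mathcal M=(G,M)$ consists of a nonempty set $M$, a totally ordered Abelian group $G$, a function $f^{\mathcal M}:M^n\to M$ for each $n$-ary function symbol $f$ and a function $P^{\mathcal M}:M^n\to\Gamma_G$ for each $n$-ary predicate symbol $P$. Terms are interpreted as usual, and the truth value $\varphi^{\mathcal M}(\bar a)\in\Gamma_G$ of a formula is defined inductively: $\bot$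 has value $0$; $\bar 1$ has value $1_G$; $P(t_1,\dots,t_n)$ has value $P^{\mathcal M}(t_1^{\mathcal M}(\bar a),\dots,t_n^{\mathcal M}(\bar a))$; $\wedge$ is interpreted by $\min$; $\to$ by the operation that sends $(a,b)$ to $\infty$ if $a\le b$ and to $b$ if $a>b$; $\otimes$ by $*$; ${}^{-1}$ by the inverse; $\forall y$ and $\exists y$ by the infimum and the supremum in $\Gamma_G$ over $y\in M$. All structures are required to be *safe*: all these infima and suprema exist. * $\mathcal M$ is *exhaustive* if every element of $G$ is the value $\varphi^{\mathcal M}(\bar a)$ of some $\tau$-formula $\varphi$ at some tuple $\bar a$ from $M$. * $\mathcal M$ is *ultrametric* if $d(a,b):=e^{\mathcal M}(a,b)^{-1}$ satisfies, for all $a,b,c\in M$: $d(a,b)=0$ if and only if $a=b$; $d(a,b)=d(b,a)$; $d(a,b)\le\max\{d(a,c),d(b,c)\}$. * An *elementary embedding* $(h,T):\mathcal M\hookrightarrow_\tau\mathcal N$ of $\mathcal M=(G,M)$ into $\mathcal N=(H,N)$ consists of an injection $h:M\to N$ and a strictly order preserving group homomorphism $T:G\to H$, extended to $\Gamma_G\to\Gamma_H$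 by $T(0)=0$ and $T(\infty)=\infty$, such that $h(f^{\mathcal M}(\bar a))=f^{\mathcal N}(h(\bar a))$ for every function symbol $f$ and tuple $\bar a$, and $T(\varphi^{\mathcal M}(\bar a))=\varphi^{\mathcal N}(h(\bar a))$ for every $\tau$-formula $\varphi$ and tuple $\bar a$ from $M$. **Theorem.** Let $\mathcal A$, $\mathcal B$ and $\mathcal M$ be exhaustive ultrametric $\tau$-structures, and let $(j,S):\mathcal M\hookrightarrow_\tau\mathcal A$ and $(k,T):\mathcal M\hookrightarrow_\tau\mathcal B$ be elementary embeddings. Then there are an exhaustive ultrametric $\tau$-structure $\mathcal N$ and elementary embeddings $(j_1,S_1):\mathcal A\hookrightarrow_\tau\mathcal N$ and $(k_1,T_1):\mathcal B\hookrightarrow_\tau\mathcal N$ such that $j_1\circ j=k_1\circ k$. -/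

import Mathlib

universe u v w w₁ w₂ w₃

namespace AddGodel

/-- The set of truth values `Γ_G = {0} ∪ G ∪ {∞}` of a totally ordered Abelian group `G`. -/
inductive Gamma (G : Type w) : Type w
  | zero : Gamma G
  | val (g : G) : Gamma G
  | infty : Gamma G

namespace Gamma

variable {G : Type w} {H : Type w₁}

/-- `Γ_G` as `G` with a new least element (`0`) and a new greatest element (`∞`). -/
def toWithBotTop : Gamma G → WithBot (WithTop G)
  | zero => ⊥
  | val g => ((g : WithTop G) : WithBot (WithTop G))
  | infty => ((⊤ : WithTop G) : WithBot (WithTop G))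

theorem toWithBotTop_injective :
    Function.Injective (toWithBotTop : Gamma G → WithBot (WithTop G)) := by
  intro a b h
  cases a <;> cases b <;>
    first
    | rfl
    | exact absurd h WithBot.bot_ne_coe
    | exact absurd h WithBot.coe_ne_bot
    | (have h2 := WithBot.coe_injective h; simp_all)

/-- The order of `G`, extended so that `0` is the least and `∞` the greatest element. -/
noncomputable instance [LinearOrder G] : LinearOrder (Gamma G) :=
  LinearOrder.lift' toWithBotTop toWithBotTop_injective

theorem zero_le [LinearOrder G] (a : Gamma G) : zero ≤ a := by
  change toWithBotTop zero ≤ toWithBotTop a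
  simp [toWithBotTop]

theorem le_infty [LinearOrder G] (a : Gamma G) : a ≤ infty := by
  change toWithBotTop a ≤ toWithBotTop infty
  cases a <;> simp [toWithBotTop]

theorem val_le_val [LinearOrder G] (a b : G) : val a ≤ val b ↔ a ≤ b := by
  change toWithBotTop (val a) ≤ toWithBotTop (val b) ↔ a ≤ b
  simp [toWithBotTop]

/-- The operation `*` of `G` extended to `Γ_G`; in particular `∞ * 0 = 0 * ∞ = 1`. -/
def mul [CommGroup G] : Gamma G → Gamma G → Gamma G
  | val a, val b => val (a * b)
  | zero, infty => val 1
  | infty, zero => val 1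
  | zero, zero => zero
  | zero, val _ => zero
  | val _, zero => zero
  | infty, infty => infty
  | infty, val _ => infty
  | val _, infty => infty

/-- The inverse of `G` extended to `Γ_G` by `0⁻¹ = ∞` and `∞⁻¹ = 0`. -/
def inv [CommGroup G] : Gamma G → Gamma G
  | zero => infty
  | val a => val a⁻¹
  | infty => zero

/-- The Gödel implication: `∞` if `a ≤ b`, and `b` otherwise. -/
noncomputable def imp [LinearOrder G] (a b : Gamma G) : Gamma G :=
  if a ≤ b then infty else b

/-- The extension of a map `G → H` to `Γ_G → Γ_H` that fixes `0` and `∞`. -/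
def map (T : G → H) : Gamma G → Gamma H
  | zero => zero
  | val g => val (T g)
  | infty => infty

open Classical in
/-- The supremum of `s` in `Γ_G` if it exists (and `0` otherwise). -/
noncomputable def sup [LinearOrder G] (s : Set (Gamma G)) : Gamma G :=
  if h : ∃ g, IsLUB s g then h.choose else zero

open Classical in
/-- The infimum of `s` in `Γ_G` if it exists (and `0` otherwise). -/
noncomputable def inf [LinearOrder G] (s : Set (Gamma G)) : Gamma G :=
  if h : ∃ g, IsGLB s g then h.choose else zero

theorem sup_eq [LinearOrder G] {s : Set (Gamma G)} {g : Gamma G} (h : IsLUB s g) :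
    sup s = g := by
  have h' : ∃ g, IsLUB s g := ⟨g, h⟩
  unfold sup
  rw [dif_pos h']
  exact h'.choose_spec.unique h

theorem inf_eq [LinearOrder G] {s : Set (Gamma G)} {g : Gamma G} (h : IsGLB s g) :
    inf s = g := by
  have h' : ∃ g, IsGLB s g := ⟨g, h⟩
  unfold inf
  rw [dif_pos h']
  exact h'.choose_spec.unique h

end Gamma

/-- Formulas of first-order additive Gödel logic over the language `L`, with the variables
`x_0, x_1, …` indexed by `ℕ`. -/
inductive Formula (L : FirstOrder.Language.{u, v}) : Type (max u v)
  | bot : Formula L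
  | one : Formula L
  | rel {n : ℕ} (P : L.Relations n) (ts : Fin n → L.Term ℕ) : Formula L
  | and (φ ψ : Formula L) : Formula L
  | imp (φ ψ : Formula L) : Formula L
  | tensor (φ ψ : Formula L) : Formula L
  | inv (φ : Formula L) : Formula L
  | all (x : ℕ) (φ : Formula L) : Formula L
  | ex (x : ℕ) (φ : Formula L) : Formula L

/-- A nonempty universe and a totally ordered Abelian group, with interpretations of the symbols
of `L`; suprema and infima are not yet required to exist. -/
structure PreStructure (L : FirstOrder.Language.{u, v}) where
  /-- The universe. -/
  carrier : Type w
  [nonempty : Nonempty carrier]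
  /-- The underlying group. -/
  group : Type w
  [commGroup : CommGroup group]
  [linearOrder : LinearOrder group]
  [isOrderedMonoid : IsOrderedMonoid group]
  /-- Interpretation of function symbols. -/
  funMap : ∀ {n : ℕ}, L.Functions n → (Fin n → carrier) → carrier
  /-- Interpretation of predicate symbols. -/
  relMap : ∀ {n : ℕ}, L.Relations n → (Fin n → carrier) → Gamma group

attribute [instance] PreStructure.nonempty PreStructure.commGroup PreStructure.linearOrder
  PreStructure.isOrderedMonoid

namespace PreStructure

variable {L : FirstOrder.Language.{u, v}} (M : PreStructure.{u, v, w} L)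

/-- The interpretation of a term under an assignment of the variables. -/
def termValue (s : ℕ → M.carrier) : L.Term ℕ → M.carrier
  | .var x => s x
  | .func f ts => M.funMap f fun i => termValue s (ts i)

/-- The truth value of a formula under an assignment of the variables. -/
noncomputable def eval : Formula L → (ℕ → M.carrier) → Gamma M.group
  | .bot, _ => Gamma.zero
  | .one, _ => Gamma.val 1
  | .rel P ts, s => M.relMap P fun i => M.termValue s (ts i)
  | .and φ ψ, s => min (eval φ s) (eval ψ s)
  | .imp φ ψ, s => Gamma.imp (eval φ s) (eval ψ s)
  | .tensor φ ψ, s => Gamma.mul (eval φ s) (eval ψ s)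
  | .inv φ, s => Gamma.inv (eval φ s)
  | .all x φ, s => Gamma.inf (Set.range fun b : M.carrier => eval φ (Function.update s x b))
  | .ex x φ, s => Gamma.sup (Set.range fun b : M.carrier => eval φ (Function.update s x b))

/-- All suprema and infima needed to interpret the quantifiers exist. -/
def IsSafe : Prop :=
  ∀ (φ : Formula L) (x : ℕ) (s : ℕ → M.carrier),
    (∃ g, IsLUB (Set.range fun b : M.carrier => M.eval φ (Function.update s x b)) g) ∧
    (∃ g, IsGLB (Set.range fun b : M.carrier => M.eval φ (Function.update s x b)) g)

end PreStructure

/-- A (safe) structure of first-order additive Gödel logic. -/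
structure Structure (L : FirstOrder.Language.{u, v}) extends PreStructure.{u, v, w} L where
  safe : toPreStructure.IsSafe

namespace Structure

variable {L : FirstOrder.Language.{u, v}} (M : Structure.{u, v, w} L)

/-- The set `Gr(M)` of the truth values in `G` of all formulas at all tuples of `M`. -/
def Gr : Set M.group :=
  {g | ∃ (φ : Formula L) (s : ℕ → M.carrier), M.eval φ s = Gamma.val g}

/-- `M` is exhaustive: its group is `Gr(M)`. -/
def IsExhaustive : Prop :=
  M.Gr = Set.univ

/-- The interpretation of `d = e⁻¹`. -/
def dist (e : L.Relations 2) (a b : M.carrier) : Gamma M.group :=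
  Gamma.inv (M.relMap e ![a, b])

/-- `M` is an ultrametric structure with respect to the binary predicate symbol `e`. -/
def IsUltrametric (e : L.Relations 2) : Prop :=
  (∀ a b : M.carrier, M.dist e a b = Gamma.zero ↔ a = b) ∧
  (∀ a b : M.carrier, M.dist e a b = M.dist e b a) ∧
  (∀ a b c : M.carrier, M.dist e a b ≤ max (M.dist e a c) (M.dist e b c))

end Structure

/-- An elementary embedding `(h, T)` of `M` into `N`: an injection `h` of the universes that
commutes with the function symbols, and a strictly order preserving group homomorphism `T` that
carries the truth values in `M` to those in `N`. -/
structure ElementaryEmbedding {L : FirstOrder.Language.{u, v}}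
    (M : Structure.{u, v, w₁} L) (N : Structure.{u, v, w₂} L) where
  /-- The map between the universes. -/
  toFun : M.carrier → N.carrier
  injective : Function.Injective toFun
  /-- The map between the groups. -/
  groupHom : M.group →* N.group
  strictMono : StrictMono groupHom
  map_fun : ∀ {n : ℕ} (f : L.Functions n) (a : Fin n → M.carrier),
    toFun (M.funMap f a) = N.funMap f (toFun ∘ a)
  map_eval : ∀ (φ : Formula L) (s : ℕ → M.carrier),
    Gamma.map groupHom (M.eval φ s) = N.eval φ (toFun ∘ s)

end AddGodel

/-! The amalgam is an ultrapower of `B` whose index set consists of the maps `A → B`. `B` embeds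
diagonally and `A` by evaluation, `a ↦ [h ↦ h a]`; the two embeddings agree over `M` once almost
every `h` satisfies `h ∘ j = k`.

Only the value `∞` has to be controlled. Since `φ → ψ` has value `∞` exactly when the value of `φ`
is at most that of `ψ`, a map preserving `∞` preserves all comparisons of truth values;
exhaustiveness then turns it into a group homomorphism, and `e` recovers equality
(`exists_elementaryEmbedding`).

The ultrafilter comes from the finite intersection property (`exists_map_eval_eq_infty`). If `φ` has
value `∞` in `A`, quantify out the elements outside `M`; the resulting formula has parameters in
`M`, so it passes through `M` to `B`, where witnesses define the map. A supremum `∞` need not be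
attained, so the formula is made two-valued before it is quantified (`crisp`).

Łoś's theorem (`ultrapower_eval`) holds for all truth values because `Γ` of the ultrapower group is
the ultrapower of `Γ_G`. To regain exhaustiveness the group is cut down to the truth values
(`core`); the required suprema and infima survive, being truth values themselves. -/

namespace AddGodel

/-! ### Truth values under order embeddings and homomorphisms -/

namespace Gamma

variable {G : Type w} {H : Type w₁}

section Order

variable [LinearOrder G] [LinearOrder H]

theorem le_zero_iff {a : Gamma G} : a ≤ zero ↔ a = zero :=
  ⟨fun h => le_antisymm h (zero_le a), fun h => h.le⟩

theorem infty_le_iff {a : Gamma G} : infty ≤ a ↔ a = infty :=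
  ⟨fun h => le_antisymm (le_infty a) h, fun h => h.ge⟩

theorem map_le_map {T : G → H} (hT : StrictMono T) {a b : Gamma G} :
    map T a ≤ map T b ↔ a ≤ b := by
  cases a <;> cases b <;>
    simp [map, zero_le, le_infty, le_zero_iff, infty_le_iff, val_le_val, hT.le_iff_le]

theorem map_injective {T : G → H} (hT : StrictMono T) : Function.Injective (map T) :=
  fun _ _ h => le_antisymm ((map_le_map hT).1 h.le) ((map_le_map hT).1 h.ge)

theorem map_min {T : G → H} (hT : StrictMono T) (a b : Gamma G) :
    map T (min a b) = min (map T a) (map T b) :=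
  Monotone.map_min fun _ _ h => (map_le_map hT).2 h

theorem map_imp {T : G → H} (hT : StrictMono T) (a b : Gamma G) :
    map T (imp a b) = imp (map T a) (map T b) := by
  unfold imp
  by_cases h : a ≤ b
  · rw [if_pos h, if_pos ((map_le_map hT).2 h)]; rfl
  · rw [if_neg h, if_neg (mt (map_le_map hT).1 h)]

theorem imp_eq_infty {a b : Gamma G} : imp a b = infty ↔ a ≤ b := by
  unfold imp
  split_ifs with h
  · simp [h]
  · exact ⟨fun hb => absurd (hb ▸ le_infty a) h, fun hab => absurd hab h⟩

theorem min_eq_infty {a b : Gamma G} : min a b = infty ↔ a = infty ∧ b = infty := by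
  simp only [← infty_le_iff, le_min_iff]

/-- Only this direction is available: a strictly increasing map reflects bounds but need not
preserve suprema. -/
theorem isLUB_of_map {T : G → H} (hT : StrictMono T) {ι : Type*} {f : ι → Gamma G} {a : Gamma G}
    (h : IsLUB (Set.range fun i => map T (f i)) (map T a)) : IsLUB (Set.range f) a := by
  constructor
  · rintro _ ⟨i, rfl⟩
    exact (map_le_map hT).1 (h.1 ⟨i, rfl⟩)
  · intro b hb
    refine (map_le_map hT).1 (h.2 ?_)
    rintro _ ⟨i, rfl⟩
    exact (map_le_map hT).2 (hb ⟨i, rfl⟩)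

theorem isGLB_of_map {T : G → H} (hT : StrictMono T) {ι : Type*} {f : ι → Gamma G} {a : Gamma G}
    (h : IsGLB (Set.range fun i => map T (f i)) (map T a)) : IsGLB (Set.range f) a := by
  constructor
  · rintro _ ⟨i, rfl⟩
    exact (map_le_map hT).1 (h.1 ⟨i, rfl⟩)
  · intro b hb
    refine (map_le_map hT).1 (h.2 ?_)
    rintro _ ⟨i, rfl⟩
    exact (map_le_map hT).2 (hb ⟨i, rfl⟩)

end Order

section Group

variable [CommGroup G] [CommGroup H]

theorem map_mul (T : G →* H) (a b : Gamma G) : map T (mul a b) = mul (map T a) (map T b) := by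
  cases a <;> cases b <;> simp [map, mul]

theorem map_inv (T : G →* H) (a : Gamma G) : map T (inv a) = inv (map T a) := by
  cases a <;> simp [map, inv]

theorem inv_eq_zero {a : Gamma G} : inv a = zero ↔ a = infty := by
  cases a <;> simp [inv]

theorem inv_eq_infty {a : Gamma G} : inv a = infty ↔ a = zero := by
  cases a <;> simp [inv]

end Group

end Gamma

/-! ### Renaming of variables and two-valued existential formulas -/

namespace Formula

variable {L : FirstOrder.Language.{u, v}}

/-- Renaming of all variables, free and bound. -/
def relabel (ρ : ℕ → ℕ) : Formula L → Formula L
  | .bot => .bot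
  | .one => .one
  | .rel P ts => .rel P fun i => (ts i).relabel ρ
  | .and φ ψ => .and (relabel ρ φ) (relabel ρ ψ)
  | .imp φ ψ => .imp (relabel ρ φ) (relabel ρ ψ)
  | .tensor φ ψ => .tensor (relabel ρ φ) (relabel ρ ψ)
  | .inv φ => .inv (relabel ρ φ)
  | .all x φ => .all (ρ x) (relabel ρ φ)
  | .ex x φ => .ex (ρ x) (relabel ρ φ)

/-- A strict upper bound of the variables of a term. -/
def termBound : L.Term ℕ → ℕ
  | .var x => x + 1
  | .func _ ts => Finset.univ.sup fun i => termBound (ts i)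

/-- A strict upper bound of the free variables of a formula. -/
def bound : Formula L → ℕ
  | .bot => 0
  | .one => 0
  | .rel _ ts => Finset.univ.sup fun i => termBound (ts i)
  | .and φ ψ => max (bound φ) (bound ψ)
  | .imp φ ψ => max (bound φ) (bound ψ)
  | .tensor φ ψ => max (bound φ) (bound ψ)
  | .inv φ => bound φ
  | .all _ φ => bound φ
  | .ex _ φ => bound φ

/-- The two-valued formula that says that `φ` has the value `∞`. -/
def crisp (φ : Formula L) : Formula L :=
  .imp (.inv φ) .bot

/-- Existential quantification over the variables of a list. -/
def exList : List ℕ → Formula L → Formula L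
  | [], φ => φ.crisp
  | x :: l, φ => .ex x (exList l φ)

/-- The conjunction of the atomic formulas `e(x, y)` for the pairs `(x, y)` of a list. -/
def eqList (e : L.Relations 2) : List (ℕ × ℕ) → Formula L
  | [] => .inv .bot
  | p :: l => .and (.rel e ![.var p.1, .var p.2]) (eqList e l)

end Formula

namespace PreStructure

variable {L : FirstOrder.Language.{u, v}} (M : PreStructure.{u, v, w} L)

theorem termValue_relabel (ρ : ℕ → ℕ) (t : L.Term ℕ) (s : ℕ → M.carrier) :
    M.termValue s (t.relabel ρ) = M.termValue (s ∘ ρ) t := by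
  induction t with
  | var x => rfl
  | func f ts ih =>
    simp only [FirstOrder.Language.Term.relabel, termValue, ih]

/-- Bound variables may be renamed along with free ones because an injective renaming causes no
capture: updating `s` at `ρ x` changes `s ∘ ρ` at `x` only. -/
theorem eval_relabel {ρ : ℕ → ℕ} (hρ : Function.Injective ρ) (φ : Formula L)
    (s : ℕ → M.carrier) : M.eval (φ.relabel ρ) s = M.eval φ (s ∘ ρ) := by
  induction φ generalizing s with
  | bot => rfl
  | one => rfl
  | rel P ts => simp only [Formula.relabel, eval, termValue_relabel]
  | and φ ψ h₁ h₂ => simp only [Formula.relabel, eval, h₁, h₂]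
  | imp φ ψ h₁ h₂ => simp only [Formula.relabel, eval, h₁, h₂]
  | tensor φ ψ h₁ h₂ => simp only [Formula.relabel, eval, h₁, h₂]
  | inv φ h => simp only [Formula.relabel, eval, h]
  | all x φ h =>
    simp only [Formula.relabel, eval, h, Function.update_comp_eq_of_injective _ hρ]
  | ex x φ h =>
    simp only [Formula.relabel, eval, h, Function.update_comp_eq_of_injective _ hρ]

theorem termValue_congr {t : L.Term ℕ} {s s' : ℕ → M.carrier}
    (h : ∀ x < Formula.termBound t, s x = s' x) : M.termValue s t = M.termValue s' t := by
  induction t with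
  | var x => exact h x (Nat.lt_succ_self x)
  | func f ts ih =>
    simp only [termValue]
    congr 1
    funext i
    refine ih i fun x hx => h x (hx.trans_le ?_)
    exact Finset.le_sup (f := fun i => Formula.termBound (ts i)) (Finset.mem_univ i)

/-- `bound` also counts quantified variables, so the hypothesis passes unchanged to the body of a
quantifier, where the updated variable agrees trivially. -/
theorem eval_congr {φ : Formula L} {s s' : ℕ → M.carrier}
    (h : ∀ x < φ.bound, s x = s' x) : M.eval φ s = M.eval φ s' := by
  induction φ generalizing s s' with
  | bot => rfl
  | one => rfl
  | rel P ts =>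
    simp only [eval]
    congr 1
    funext i
    refine M.termValue_congr fun x hx => h x (hx.trans_le ?_)
    exact Finset.le_sup (f := fun i => Formula.termBound (ts i)) (Finset.mem_univ i)
  | and φ ψ h₁ h₂ =>
    simp only [eval, h₁ fun x hx => h x (lt_max_of_lt_left hx),
      h₂ fun x hx => h x (lt_max_of_lt_right hx)]
  | imp φ ψ h₁ h₂ =>
    simp only [eval, h₁ fun x hx => h x (lt_max_of_lt_left hx),
      h₂ fun x hx => h x (lt_max_of_lt_right hx)]
  | tensor φ ψ h₁ h₂ =>
    simp only [eval, h₁ fun x hx => h x (lt_max_of_lt_left hx),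
      h₂ fun x hx => h x (lt_max_of_lt_right hx)]
  | inv φ ih => simp only [eval, ih h]
  | all x φ ih =>
    simp only [eval]
    congr 2
    funext b
    refine ih fun y hy => ?_
    by_cases hyx : y = x
    · subst hyx; simp
    · simp [hyx, h y hy]
  | ex x φ ih =>
    simp only [eval]
    congr 2
    funext b
    refine ih fun y hy => ?_
    by_cases hyx : y = x
    · subst hyx; simp
    · simp [hyx, h y hy]

/-- The assignment with `s` at the even and `t` at the odd variables. -/
def interleave {α : Type*} (s t : ℕ → α) (x : ℕ) : α :=
  if x % 2 = 0 then s (x / 2) else t (x / 2)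

theorem interleave_even {α : Type*} (s t : ℕ → α) :
    (interleave s t ∘ fun x => 2 * x) = s := by
  funext x
  have h : 2 * x % 2 = 0 := by omega
  have h' : 2 * x / 2 = x := by omega
  simp [interleave]

theorem interleave_odd {α : Type*} (s t : ℕ → α) :
    (interleave s t ∘ fun x => 2 * x + 1) = t := by
  funext x
  have h : (2 * x + 1) % 2 = 1 := by omega
  have h' : (2 * x + 1) / 2 = x := by omega
  simp [interleave, h, h']

theorem comp_interleave {α β : Type*} (f : α → β) (s t : ℕ → α) :
    f ∘ interleave s t = interleave (f ∘ s) (f ∘ t) := by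
  funext x
  simp only [interleave, Function.comp_apply]
  split_ifs <;> rfl

/-- With its odd counterpart, this puts two formulas at unrelated assignments under one connective
at a single assignment. -/
theorem eval_relabel_even (φ : Formula L) (s t : ℕ → M.carrier) :
    M.eval (φ.relabel fun x => 2 * x) (interleave s t) = M.eval φ s := by
  rw [eval_relabel _ fun x y h => by simpa using h, interleave_even]

theorem eval_relabel_odd (φ : Formula L) (s t : ℕ → M.carrier) :
    M.eval (φ.relabel fun x => 2 * x + 1) (interleave s t) = M.eval φ t := by
  rw [eval_relabel _ fun x y h => by simpa using h, interleave_odd]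

theorem eval_crisp_eq_infty {φ : Formula L} {s : ℕ → M.carrier} :
    M.eval φ.crisp s = Gamma.infty ↔ M.eval φ s = Gamma.infty := by
  simp only [Formula.crisp, eval, Gamma.imp_eq_infty, Gamma.le_zero_iff, Gamma.inv_eq_zero]

theorem eval_crisp_eq_zero {φ : Formula L} {s : ℕ → M.carrier} :
    M.eval φ.crisp s = Gamma.zero ↔ M.eval φ s ≠ Gamma.infty := by
  simp only [Formula.crisp, eval, Gamma.imp, Gamma.le_zero_iff, Gamma.inv_eq_zero]
  split_ifs with h <;> simp [h]

/-- A supremum of values in `{0, ∞}` is `∞` only if it is attained. Two-valuedness is therefore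
carried through the induction together with the existence of witnesses. -/
theorem eval_exList_zero_or_infty (l : List ℕ) (φ : Formula L) (s : ℕ → M.carrier) :
    (M.eval (φ.exList l) s = Gamma.infty ↔
      ∃ t : ℕ → M.carrier, (∀ x ∉ l, t x = s x) ∧ M.eval φ t = Gamma.infty) ∧
    (M.eval (φ.exList l) s = Gamma.zero ∨ M.eval (φ.exList l) s = Gamma.infty) := by
  induction l generalizing s with
  | nil =>
    simp only [Formula.exList, eval_crisp_eq_infty, eval_crisp_eq_zero]
    refine ⟨⟨fun h => ⟨s, fun _ _ => rfl, h⟩, ?_⟩, (em _).symm⟩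
    rintro ⟨t, ht, h⟩
    rwa [← show t = s from funext fun x => ht x (by simp)]
  | cons y l ih =>
    by_cases hb : ∃ b, M.eval (φ.exList l) (Function.update s y b) = Gamma.infty
    · obtain ⟨b, hb⟩ := hb
      have hs : M.eval (φ.exList (y :: l)) s = Gamma.infty :=
        Gamma.sup_eq ⟨fun a _ => Gamma.le_infty a, fun a ha => hb ▸ ha ⟨b, rfl⟩⟩
      refine ⟨⟨fun _ => ?_, fun _ => hs⟩, Or.inr hs⟩
      obtain ⟨t, ht, h⟩ := (ih _).1.1 hb
      refine ⟨t, fun x hx => ?_, h⟩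
      rw [List.mem_cons, not_or] at hx
      rw [ht x hx.2, Function.update_of_ne hx.1]
    · push Not at hb
      have hs : M.eval (φ.exList (y :: l)) s = Gamma.zero := by
        refine Gamma.sup_eq ⟨?_, fun a _ => Gamma.zero_le a⟩
        rintro _ ⟨b, rfl⟩
        exact (((ih _).2.resolve_right (hb b))).le
      refine ⟨⟨fun h => by simp [hs] at h, ?_⟩, Or.inl hs⟩
      rintro ⟨t, ht, h⟩
      refine absurd ((ih (Function.update s y (t y))).1.2 ⟨t, fun x hx => ?_, h⟩) (hb _)
      by_cases hxy : x = y
      · subst hxy; simp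
      · rw [Function.update_of_ne hxy]
        exact ht x (by simp [hxy, hx])

theorem eval_exList {l : List ℕ} {φ : Formula L} {s : ℕ → M.carrier} :
    M.eval (φ.exList l) s = Gamma.infty ↔
      ∃ t : ℕ → M.carrier, (∀ x ∉ l, t x = s x) ∧ M.eval φ t = Gamma.infty :=
  (M.eval_exList_zero_or_infty l φ s).1

theorem eval_atom (e : L.Relations 2) (t t' : L.Term ℕ) (s : ℕ → M.carrier) :
    M.eval (.rel e ![t, t']) s = M.relMap e ![M.termValue s t, M.termValue s t'] := by
  simp only [eval]
  congr 1
  funext i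
  fin_cases i <;> rfl

theorem eval_eqList {e : L.Relations 2} {l : List (ℕ × ℕ)} {s : ℕ → M.carrier} :
    M.eval (.eqList e l) s = Gamma.infty ↔
      ∀ p ∈ l, M.relMap e ![s p.1, s p.2] = Gamma.infty := by
  induction l with
  | nil => simp [Formula.eqList, eval, Gamma.inv]
  | cons p l ih =>
    rw [Formula.eqList, eval, Gamma.min_eq_infty, ih, eval_atom]
    simp [termValue]

end PreStructure

namespace Structure

variable {L : FirstOrder.Language.{u, v}}

theorem IsUltrametric.relMap_eq_infty {M : Structure.{u, v, w} L} {e : L.Relations 2}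
    (h : M.IsUltrametric e) {a b : M.carrier} :
    M.relMap e ![a, b] = Gamma.infty ↔ a = b := by
  rw [← h.1, dist, Gamma.inv_eq_zero]

end Structure

/-! ### From preservation of `∞` to elementary embeddings -/

section Preserves

variable {L : FirstOrder.Language.{u, v}} {A : Structure.{u, v, w₁} L}
  {N : Structure.{u, v, w₂} L} {e : L.Relations 2} {h : A.carrier → N.carrier}

/-- `h` carries the formulas with value `∞` in `A` to formulas with value `∞` in `N`. -/
def PreservesTruth (A : Structure.{u, v, w₁} L) (N : Structure.{u, v, w₂} L)
    (h : A.carrier → N.carrier) : Prop :=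
  ∀ (φ : Formula L) (s : ℕ → A.carrier), A.eval φ s = Gamma.infty → N.eval φ (h ∘ s) = Gamma.infty

namespace PreservesTruth

/-- Failure to be `∞` is itself expressed by a formula of value `∞`, the inverse of `φ.crisp`, so
preservation implies reflection. -/
theorem eval_eq_infty (hh : PreservesTruth A N h) {φ : Formula L} {s : ℕ → A.carrier} :
    N.eval φ (h ∘ s) = Gamma.infty ↔ A.eval φ s = Gamma.infty := by
  refine ⟨fun hN => ?_, hh φ s⟩
  by_contra hA
  have h₁ := hh (.inv φ.crisp) s (Gamma.inv_eq_infty.2 (A.eval_crisp_eq_zero.2 hA))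
  exact N.eval_crisp_eq_zero.1 (Gamma.inv_eq_infty.1 h₁) hN

theorem eval_le_eval (hh : PreservesTruth A N h) {φ ψ : Formula L} {s t : ℕ → A.carrier} :
    N.eval φ (h ∘ s) ≤ N.eval ψ (h ∘ t) ↔ A.eval φ s ≤ A.eval ψ t := by
  have := hh.eval_eq_infty (φ := .imp (φ.relabel fun x => 2 * x) (ψ.relabel fun x => 2 * x + 1))
    (s := PreStructure.interleave s t)
  simpa only [PreStructure.eval, PreStructure.comp_interleave, PreStructure.eval_relabel_even,
    PreStructure.eval_relabel_odd, Gamma.imp_eq_infty] using this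

theorem eval_eq_eval (hh : PreservesTruth A N h) {φ ψ : Formula L} {s t : ℕ → A.carrier} :
    N.eval φ (h ∘ s) = N.eval ψ (h ∘ t) ↔ A.eval φ s = A.eval ψ t := by
  simp only [le_antisymm_iff, hh.eval_le_eval]

/-- The value in `N` depends only on the value in `A`. Comparison with `⊥` excludes `0`, and
reflection of `∞` excludes `∞`. -/
theorem exists_groupValue (hh : PreservesTruth A N h) (hA : A.IsExhaustive) (g : A.group) :
    ∃ g' : N.group, ∀ (φ : Formula L) (s : ℕ → A.carrier),
      A.eval φ s = Gamma.val g → N.eval φ (h ∘ s) = Gamma.val g' := by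
  obtain ⟨φ, s, hφ⟩ : g ∈ A.Gr := hA ▸ Set.mem_univ g
  have h₀ : N.eval φ (h ∘ s) ≠ Gamma.zero := fun h₀ => by
    have := (hh.eval_eq_eval (ψ := .bot) (t := s)).1 h₀
    simp [hφ, PreStructure.eval] at this
  have h₁ : N.eval φ (h ∘ s) ≠ Gamma.infty := fun h₁ => by
    simp [hh.eval_eq_infty, hφ] at h₁
  cases hg : N.eval φ (h ∘ s) with
  | zero => exact absurd hg h₀
  | infty => exact absurd hg h₁
  | val g' => exact ⟨g', fun ψ t hψ => hg ▸ hh.eval_eq_eval.2 (hψ.trans hφ.symm)⟩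

/-- Exhaustiveness makes the map of values total on the group; implication makes it strictly
monotone and `⊗` multiplicative. Injectivity and compatibility with functions hold because `e = ∞`
means equality in both structures. -/
theorem exists_elementaryEmbedding (hh : PreservesTruth A N h) (hA : A.IsExhaustive)
    (hAe : A.IsUltrametric e) (hNe : N.IsUltrametric e) :
    ∃ j : ElementaryEmbedding A N, j.toFun = h := by
  choose T hT using hh.exists_groupValue hA
  have hval : ∀ g, ∃ (φ : Formula L) (s : ℕ → A.carrier), A.eval φ s = Gamma.val g := fun g =>
    show g ∈ A.Gr from hA ▸ Set.mem_univ g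
  have hmono : StrictMono T := by
    refine strictMono_of_le_iff_le fun g g' => ?_
    obtain ⟨φ, s, hφ⟩ := hval g
    obtain ⟨ψ, t, hψ⟩ := hval g'
    rw [← Gamma.val_le_val (T g), ← Gamma.val_le_val g, ← hT _ _ _ hφ, ← hT _ _ _ hψ, ← hφ, ← hψ,
      hh.eval_le_eval]
  have hmul : ∀ g g', T (g * g') = T g * T g' := by
    intro g g'
    obtain ⟨φ, s, hφ⟩ := hval g
    obtain ⟨ψ, t, hψ⟩ := hval g'
    have h₁ := hT (g * g') (.tensor (φ.relabel fun x => 2 * x) (ψ.relabel fun x => 2 * x + 1))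
      (PreStructure.interleave s t)
    simp only [PreStructure.eval, PreStructure.comp_interleave, PreStructure.eval_relabel_even,
      PreStructure.eval_relabel_odd, hφ, hψ, hT _ _ _ hφ, hT _ _ _ hψ, Gamma.mul,
      forall_const] at h₁
    exact (Gamma.val.inj h₁).symm
  have hrel : ∀ a b : A.carrier, h a = h b ↔ a = b := fun a b => by
    rw [← hAe.relMap_eq_infty, ← hNe.relMap_eq_infty]
    have := hh.eval_eq_infty (φ := .rel e ![.var 0, .var 1]) (s := fun x => if x = 0 then a else b)
    simpa only [PreStructure.eval_atom, PreStructure.termValue, Function.comp_apply,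
      if_true, one_ne_zero, if_false] using this
  refine ⟨⟨h, fun a b => (hrel a b).1, MonoidHom.mk' T hmul, hmono, ?_, ?_⟩, rfl⟩
  · intro n f a
    -- Variable `0` carries the value `f(a)` and variable `i + 1` the argument `a i`; the remaining
    -- variables are filler.
    have h₁ := hh (.rel e ![.var 0, .func f fun i => .var (i + 1)])
      (fun x => if hx : 0 < x ∧ x - 1 < n then a ⟨x - 1, hx.2⟩ else A.funMap f a)
    simp only [PreStructure.eval_atom, PreStructure.termValue] at h₁
    simpa [hAe.relMap_eq_infty, hNe.relMap_eq_infty, Function.comp_def] using h₁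
  · intro φ s
    cases hφ : A.eval φ s with
    | zero => exact (hh.eval_eq_eval (ψ := .bot) (t := s)).2 hφ |>.symm
    | infty => exact (hh φ s hφ).symm
    | val g => exact (hT g φ s hφ).symm

end PreservesTruth

end Preserves

/-! ### Truth values over an ultrapower of the group -/

namespace Gamma

open Filter

variable {I : Type w₁} {G : Type w}

/-- The element of `G` that `a` is, and `1` if `a` is `0` or `∞`. -/
def toGroup [One G] : Gamma G → G
  | val g => g
  | _ => 1

open Classical in
/-- The truth value over the ultrapower of `G` represented by a family of truth values. -/
noncomputable def ofFamily [One G] (U : Ultrafilter I) (f : I → Gamma G) :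
    Gamma (Germ (U : Filter I) G) :=
  if ∀ᶠ i in U, f i = zero then zero
  else if ∀ᶠ i in U, f i = infty then infty
  else val ((fun i => (f i).toGroup : I → G) : Germ (U : Filter I) G)

theorem eventually_cases (U : Ultrafilter I) (f : I → Gamma G) :
    (∀ᶠ i in U, f i = zero) ∨ (∀ᶠ i in U, f i = infty) ∨
      ∃ g : I → G, ∀ᶠ i in U, f i = val (g i) := by
  have h : ∀ᶠ i in U, f i = zero ∨ f i = infty ∨ ∃ g, f i = val g :=
    Eventually.of_forall fun i => by cases f i <;> simp
  rw [Ultrafilter.eventually_or, Ultrafilter.eventually_or] at h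
  refine h.imp_right (Or.imp_right fun h => ?_)
  obtain ⟨i, g, -⟩ := h.exists
  have : Nonempty G := ⟨g⟩
  choose! g hg using fun i (hi : ∃ g, f i = val g) => hi
  exact ⟨g, h.mono hg⟩

/-- An ultrafilter decides which of the three kinds of truth value a family takes, so up to almost
everywhere equality only these families occur. -/
theorem family_induction {U : Ultrafilter I} {p : (I → Gamma G) → Prop}
    (congr : ∀ f g, (∀ᶠ i in U, f i = g i) → p g → p f)
    (zero : p fun _ => zero) (infty : p fun _ => infty) (val : ∀ g : I → G, p fun i => val (g i))
    (f : I → Gamma G) : p f := by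
  rcases eventually_cases U f with h | h | ⟨g, h⟩
  · exact congr _ _ h zero
  · exact congr _ _ h infty
  · exact congr _ _ h (val g)

section One

variable [One G] {U : Ultrafilter I}

theorem ofFamily_congr {f g : I → Gamma G} (h : ∀ᶠ i in U, f i = g i) :
    ofFamily U f = ofFamily U g := by
  have h₁ : ∀ a, (∀ᶠ i in U, f i = a) ↔ ∀ᶠ i in U, g i = a := fun a =>
    eventually_congr (h.mono fun i hi => by rw [hi])
  have h₂ : ((fun i => (f i).toGroup : I → G) : Germ (U : Filter I) G) =
      (fun i => (g i).toGroup : I → G) := Germ.coe_eq.2 (h.mono fun i hi => by simp only [hi])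
  classical
  rw [ofFamily, ofFamily, h₂]
  simp only [h₁]

theorem ofFamily_zero : ofFamily U (fun _ => (zero : Gamma G)) = zero := by
  simp [ofFamily]

theorem ofFamily_infty : ofFamily U (fun _ => (infty : Gamma G)) = infty := by
  simp [ofFamily, U.neBot.ne]

theorem ofFamily_val (g : I → G) :
    ofFamily U (fun i => val (g i)) = val (g : Germ (U : Filter I) G) := by
  simp [ofFamily, toGroup, U.neBot.ne]

theorem ofFamily_surjective (a : Gamma (Germ (U : Filter I) G)) :
    ∃ f : I → Gamma G, ofFamily U f = a := by
  cases a with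
  | zero => exact ⟨_, ofFamily_zero⟩
  | infty => exact ⟨_, ofFamily_infty⟩
  | val g =>
    induction g using Germ.inductionOn with
    | h g => exact ⟨_, ofFamily_val g⟩

end One

section Group

variable [CommGroup G] {U : Ultrafilter I}

theorem ofFamily_inv (f : I → Gamma G) :
    ofFamily U (fun i => inv (f i)) = inv (ofFamily U f) := by
  induction f using family_induction (U := U) with
  | congr f g h ih =>
    rw [ofFamily_congr h, ← ih]
    exact ofFamily_congr (h.mono fun i hi => by rw [hi])
  | zero => simp only [inv, ofFamily_zero, ofFamily_infty]
  | infty => simp only [inv, ofFamily_zero, ofFamily_infty]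
  | val g => simp only [inv, ofFamily_val]; rfl

theorem ofFamily_mul (f g : I → Gamma G) :
    ofFamily U (fun i => mul (f i) (g i)) = mul (ofFamily U f) (ofFamily U g) := by
  induction f using family_induction (U := U) with
  | congr f f' h ih =>
    rw [ofFamily_congr h, ← ih]
    exact ofFamily_congr (h.mono fun i hi => by rw [hi])
  | _ =>
    induction g using family_induction (U := U) with
    | congr g g' h ih =>
      rw [ofFamily_congr h, ← ih]
      exact ofFamily_congr (h.mono fun i hi => by rw [hi])
    | _ =>
      simp only [mul, ofFamily_zero, ofFamily_infty, ofFamily_val]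
      try rfl

end Group

section Order

variable [One G] [LinearOrder G] {U : Ultrafilter I}

/-- Together with `ofFamily_surjective`, this identifies `Γ` of the ultrapower group with the
ultrapower of `Γ_G`. -/
theorem ofFamily_le {f g : I → Gamma G} :
    ofFamily U f ≤ ofFamily U g ↔ ∀ᶠ i in U, f i ≤ g i := by
  induction f using family_induction (U := U) with
  | congr f f' h ih =>
    rw [ofFamily_congr h, ih]
    exact eventually_congr (h.mono fun i hi => by rw [hi])
  | _ =>
    induction g using family_induction (U := U) with
    | congr g g' h ih =>
      rw [ofFamily_congr h, ih]
      exact eventually_congr (h.mono fun i hi => by rw [hi])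
    | _ =>
      simp [ofFamily_zero, ofFamily_infty, ofFamily_val, zero_le, le_infty, le_zero_iff,
        infty_le_iff, val_le_val, Germ.coe_le, EventuallyLE, U.neBot.ne]

theorem ofFamily_eq {f g : I → Gamma G} :
    ofFamily U f = ofFamily U g ↔ ∀ᶠ i in U, f i = g i := by
  simp only [le_antisymm_iff, ofFamily_le, eventually_and]

theorem ofFamily_min (f g : I → Gamma G) :
    ofFamily U (fun i => min (f i) (g i)) = min (ofFamily U f) (ofFamily U g) := by
  rcases le_total (ofFamily U f) (ofFamily U g) with h | h
  · rw [min_eq_left h]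
    exact ofFamily_congr ((ofFamily_le.1 h).mono fun i hi => min_eq_left hi)
  · rw [min_eq_right h]
    exact ofFamily_congr ((ofFamily_le.1 h).mono fun i hi => min_eq_right hi)

theorem ofFamily_max (f g : I → Gamma G) :
    ofFamily U (fun i => max (f i) (g i)) = max (ofFamily U f) (ofFamily U g) := by
  rcases le_total (ofFamily U f) (ofFamily U g) with h | h
  · rw [max_eq_right h]
    exact ofFamily_congr ((ofFamily_le.1 h).mono fun i hi => max_eq_right hi)
  · rw [max_eq_left h]
    exact ofFamily_congr ((ofFamily_le.1 h).mono fun i hi => max_eq_left hi)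

theorem ofFamily_imp (f g : I → Gamma G) :
    ofFamily U (fun i => imp (f i) (g i)) = imp (ofFamily U f) (ofFamily U g) := by
  by_cases h : ofFamily U f ≤ ofFamily U g
  · rw [imp_eq_infty.2 h, ← ofFamily_infty (U := U)]
    exact ofFamily_congr ((ofFamily_le.1 h).mono fun i hi => imp_eq_infty.2 hi)
  · have h' := h
    rw [ofFamily_le, ← Ultrafilter.eventually_not] at h'
    rw [imp, if_neg h]
    exact ofFamily_congr (h'.mono fun i hi => if_neg hi)

theorem isLUB_ofFamily {β : Type*} [Nonempty β] {F : I → β → Gamma G} {a : I → Gamma G}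
    (h : ∀ i, IsLUB (Set.range (F i)) (a i)) :
    IsLUB (Set.range fun b : I → β => ofFamily U fun i => F i (b i)) (ofFamily U a) := by
  constructor
  · rintro _ ⟨b, rfl⟩
    exact ofFamily_le.2 (Eventually.of_forall fun i => (h i).1 ⟨b i, rfl⟩)
  · intro c hc
    obtain ⟨c, rfl⟩ := ofFamily_surjective c
    by_contra hlt
    rw [ofFamily_le, ← Ultrafilter.eventually_not] at hlt
    -- No supremum has to be attained: wherever `c i` lies below `a i`, some value already exceeds
    -- `c i`. At the other indices the choice is irrelevant.
    have hb : ∀ i, ∃ b, ¬ a i ≤ c i → ¬ F i b ≤ c i := by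
      intro i
      by_cases hi : a i ≤ c i
      · exact ⟨Classical.arbitrary β, fun h => absurd hi h⟩
      · by_contra! hF
        refine hi ((h i).2 ?_)
        rintro _ ⟨b, rfl⟩
        exact (hF b).2
    choose b hb using hb
    have h₁ := ofFamily_le.1 (hc ⟨b, rfl⟩)
    obtain ⟨i, hi, hi'⟩ := (h₁.and hlt).exists
    exact hb i hi' hi

theorem isGLB_ofFamily {β : Type*} [Nonempty β] {F : I → β → Gamma G} {a : I → Gamma G}
    (h : ∀ i, IsGLB (Set.range (F i)) (a i)) :
    IsGLB (Set.range fun b : I → β => ofFamily U fun i => F i (b i)) (ofFamily U a) := by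
  constructor
  · rintro _ ⟨b, rfl⟩
    exact ofFamily_le.2 (Eventually.of_forall fun i => (h i).1 ⟨b i, rfl⟩)
  · intro c hc
    obtain ⟨c, rfl⟩ := ofFamily_surjective c
    by_contra hlt
    rw [ofFamily_le, ← Ultrafilter.eventually_not] at hlt
    have hb : ∀ i, ∃ b, ¬ c i ≤ a i → ¬ c i ≤ F i b := by
      intro i
      by_cases hi : c i ≤ a i
      · exact ⟨Classical.arbitrary β, fun h => absurd hi h⟩
      · by_contra! hF
        refine hi ((h i).2 ?_)
        rintro _ ⟨b, rfl⟩
        exact (hF b).2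
    choose b hb using hb
    have h₁ := ofFamily_le.1 (hc ⟨b, rfl⟩)
    obtain ⟨i, hi, hi'⟩ := (h₁.and hlt).exists
    exact hb i hi' hi

end Order

end Gamma

/-! ### Ultrapowers and Łoś's theorem -/

section Ultrapower

open Filter

variable {L : FirstOrder.Language.{u, v}} {I : Type w₁} (U : Ultrafilter I)

/-- The ultrapower of `B`, with the ultrapower of the group of `B` as its group. -/
noncomputable abbrev PreStructure.ultrapower (B : PreStructure.{u, v, w} L) :
    PreStructure.{u, v, max w₁ w} L where
  carrier := Germ (U : Filter I) B.carrier
  nonempty := ⟨((fun _ => Classical.arbitrary B.carrier : I → B.carrier) : Germ (U : Filter I) B.carrier)⟩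
  group := Germ (U : Filter I) B.group
  funMap f a := ((fun i => B.funMap f fun l => (a l).out i : I → B.carrier) : Germ _ _)
  relMap P a := Gamma.ofFamily U fun i => B.relMap P fun l => (a l).out i

namespace PreStructure

variable {U} {B : PreStructure.{u, v, w} L}

/-- The operations are defined through chosen representatives. As arities are finite, these agree
simultaneously with any given representatives on a large set. -/
theorem eventually_out_eq {n : ℕ} (a : Fin n → I → B.carrier) :
    ∀ᶠ i in U, (fun l => (a l : Germ (U : Filter I) B.carrier).out i) = fun l => a l i := by
  have h : ∀ l, ∀ᶠ i in U, (a l : Germ (U : Filter I) B.carrier).out i = a l i := fun l =>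
    Germ.coe_eq.1 (Quotient.out_eq' _)
  exact (eventually_all.2 h).mono fun i hi => funext hi

theorem ultrapower_funMap {n : ℕ} (f : L.Functions n) (a : Fin n → I → B.carrier) :
    (B.ultrapower U).funMap f (fun l => (a l : Germ (U : Filter I) B.carrier)) =
      ((fun i => B.funMap f fun l => a l i : I → B.carrier) : Germ (U : Filter I) B.carrier) :=
  Germ.coe_eq.2 ((eventually_out_eq a).mono fun i hi => by simp only [hi])

theorem ultrapower_relMap {n : ℕ} (P : L.Relations n) (a : Fin n → I → B.carrier) :
    (B.ultrapower U).relMap P (fun l => (a l : Germ (U : Filter I) B.carrier)) =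
      Gamma.ofFamily U fun i => B.relMap P fun l => a l i :=
  Gamma.ofFamily_congr ((eventually_out_eq a).mono fun i hi => by simp only [hi])

theorem ultrapower_termValue (t : L.Term ℕ) (s : ℕ → I → B.carrier) :
    (B.ultrapower U).termValue (fun x => (s x : Germ (U : Filter I) B.carrier)) t =
      ((fun i => B.termValue (fun x => s x i) t : I → B.carrier) :
        Germ (U : Filter I) B.carrier) := by
  induction t with
  | var x => rfl
  | func f ts ih =>
    simp only [termValue, ih]
    exact ultrapower_funMap f _

theorem update_coe_germ {β : Type*} (s : ℕ → I → β) (x : ℕ) (b : I → β) :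
    Function.update (fun y => (s y : Germ (U : Filter I) β)) x (b : Germ (U : Filter I) β) =
      fun y => ((Function.update s x b y : I → β) : Germ (U : Filter I) β) := by
  funext y
  by_cases h : y = x
  · subst h; simp
  · simp [h]

theorem update_apply_family {β : Type*} (s : ℕ → I → β) (x : ℕ) (b : I → β) (i : I) :
    (fun y => Function.update s x b y i) = Function.update (fun y => s y i) x (b i) := by
  funext y
  by_cases h : y = x
  · subst h; simp
  · simp [h]

theorem range_germ {β γ : Type*} (F : Germ (U : Filter I) β → γ) :
    Set.range F = Set.range fun b : I → β => F b := by
  ext c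
  constructor
  · rintro ⟨b, rfl⟩
    induction b using Germ.inductionOn with
    | h b => exact ⟨b, rfl⟩
  · rintro ⟨b, rfl⟩
    exact ⟨_, rfl⟩

theorem exists_eq_coe_germ {β : Type*} (s : ℕ → Germ (U : Filter I) β) :
    ∃ s' : ℕ → I → β, s = fun x => (s' x : Germ (U : Filter I) β) :=
  ⟨fun x => (s x).out, funext fun x => (Quotient.out_eq' (s x)).symm⟩

end PreStructure

namespace Structure

variable {U} (B : Structure.{u, v, w} L)

theorem isLUB_eval (φ : Formula L) (x : ℕ) (s : ℕ → B.carrier) :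
    IsLUB (Set.range fun b => B.eval φ (Function.update s x b)) (B.eval (.ex x φ) s) := by
  obtain ⟨g, hg⟩ := (B.safe φ x s).1
  rw [PreStructure.eval, Gamma.sup_eq hg]
  exact hg

theorem isGLB_eval (φ : Formula L) (x : ℕ) (s : ℕ → B.carrier) :
    IsGLB (Set.range fun b => B.eval φ (Function.update s x b)) (B.eval (.all x φ) s) := by
  obtain ⟨g, hg⟩ := (B.safe φ x s).2
  rw [PreStructure.eval, Gamma.inf_eq hg]
  exact hg

variable {B}

theorem range_eval_ultrapower {φ : Formula L}
    (h : ∀ s : ℕ → I → B.carrier,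
      (B.toPreStructure.ultrapower U).eval φ (fun x => (s x : Germ (U : Filter I) B.carrier)) =
        Gamma.ofFamily U fun i => B.eval φ fun x => s x i)
    (x : ℕ) (s : ℕ → I → B.carrier) :
    (Set.range fun b => (B.toPreStructure.ultrapower U).eval φ
      (Function.update (fun x => (s x : Germ (U : Filter I) B.carrier)) x b)) =
    Set.range fun b : I → B.carrier =>
      Gamma.ofFamily U fun i => B.eval φ (Function.update (fun x => s x i) x (b i)) := by
  refine (PreStructure.range_germ _).trans ?_
  simp only [PreStructure.update_coe_germ, h, PreStructure.update_apply_family]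

/-- Łoś's theorem. Safety of `B` supplies the bound at each index, and `isLUB_ofFamily` and
`isGLB_ofFamily` assemble these into the bound over all germs. -/
theorem ultrapower_eval (φ : Formula L) (s : ℕ → I → B.carrier) :
    (B.toPreStructure.ultrapower U).eval φ (fun x => (s x : Germ (U : Filter I) B.carrier)) =
      Gamma.ofFamily U fun i => B.eval φ fun x => s x i := by
  induction φ generalizing s with
  | bot => exact Gamma.ofFamily_zero.symm
  | one => exact (Gamma.ofFamily_val _).symm
  | rel P ts =>
    simp only [PreStructure.eval, PreStructure.ultrapower_termValue]
    exact PreStructure.ultrapower_relMap P _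
  | and φ ψ h₁ h₂ =>
    simp only [PreStructure.eval, h₁, h₂]
    exact (Gamma.ofFamily_min _ _).symm
  | imp φ ψ h₁ h₂ =>
    simp only [PreStructure.eval, h₁, h₂]
    exact (Gamma.ofFamily_imp _ _).symm
  | tensor φ ψ h₁ h₂ =>
    simp only [PreStructure.eval, h₁, h₂]
    exact (Gamma.ofFamily_mul _ _).symm
  | inv φ h =>
    simp only [PreStructure.eval, h]
    exact (Gamma.ofFamily_inv _).symm
  | all x φ h =>
    refine Gamma.inf_eq ?_
    rw [range_eval_ultrapower h]
    exact Gamma.isGLB_ofFamily fun i => B.isGLB_eval φ x _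
  | ex x φ h =>
    refine Gamma.sup_eq ?_
    rw [range_eval_ultrapower h]
    exact Gamma.isLUB_ofFamily fun i => B.isLUB_eval φ x _

theorem isSafe_ultrapower (B : Structure.{u, v, w} L) :
    (B.toPreStructure.ultrapower U).IsSafe := by
  intro φ x s
  obtain ⟨s, rfl⟩ := PreStructure.exists_eq_coe_germ s
  rw [range_eval_ultrapower (ultrapower_eval φ)]
  exact ⟨⟨_, Gamma.isLUB_ofFamily fun i => B.isLUB_eval φ x _⟩,
    ⟨_, Gamma.isGLB_ofFamily fun i => B.isGLB_eval φ x _⟩⟩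

variable (U) in
/-- The ultrapower of a structure. -/
noncomputable abbrev ultrapower (B : Structure.{u, v, w} L) : Structure.{u, v, max w₁ w} L where
  toPreStructure := B.toPreStructure.ultrapower U
  safe := B.isSafe_ultrapower

theorem ultrapower_dist (e : L.Relations 2) (a b : I → B.carrier) :
    (B.ultrapower U).dist e (a : Germ (U : Filter I) B.carrier) (b : Germ (U : Filter I) _) =
      Gamma.ofFamily U fun i => B.dist e (a i) (b i) := by
  have h₁ : (fun l => ((![a, b] l : I → B.carrier) : Germ (U : Filter I) B.carrier)) =
      ![(a : Germ (U : Filter I) B.carrier), (b : Germ (U : Filter I) B.carrier)] := by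
    funext l; fin_cases l <;> rfl
  have h₂ : ∀ i, (fun l => (![a, b] l : I → B.carrier) i) = ![a i, b i] := by
    intro i; funext l; fin_cases l <;> rfl
  have h : (B.toPreStructure.ultrapower U).relMap e ![a, b] =
      Gamma.ofFamily U fun i => B.relMap e ![a i, b i] := by
    rw [← h₁, PreStructure.ultrapower_relMap]
    simp only [h₂]
  unfold dist
  rw [Gamma.ofFamily_inv]
  exact congrArg Gamma.inv h

theorem IsUltrametric.ultrapower {e : L.Relations 2} (h : B.IsUltrametric e) :
    (B.ultrapower U).IsUltrametric e := by
  refine ⟨fun a b => ?_, fun a b => ?_, fun a b c => ?_⟩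
  · refine Germ.inductionOn₂ a b fun a b => ?_
    rw [ultrapower_dist, ← Gamma.ofFamily_zero (U := U), Gamma.ofFamily_eq]
    simp only [h.1]
    exact Germ.coe_eq.symm
  · refine Germ.inductionOn₂ a b fun a b => ?_
    rw [ultrapower_dist, ultrapower_dist]
    simp only [h.2.1 (a _)]
  · refine Germ.inductionOn₃ a b c fun a b c => ?_
    rw [ultrapower_dist, ultrapower_dist, ultrapower_dist]
    refine le_of_le_of_eq (Gamma.ofFamily_le.2 (Eventually.of_forall fun i => ?_))
      (Gamma.ofFamily_max _ _)
    exact h.2.2 _ _ _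

end Structure

end Ultrapower

/-! ### Shrinking the group to the truth values -/

namespace Structure

variable {L : FirstOrder.Language.{u, v}} (N : Structure.{u, v, w} L)

/-- The subgroup of the truth values of formulas. -/
def grSubgroup : Subgroup N.group where
  carrier := N.Gr
  one_mem' := ⟨.one, fun _ => Classical.arbitrary _, rfl⟩
  mul_mem' := by
    rintro _ _ ⟨φ, s, hφ⟩ ⟨ψ, t, hψ⟩
    refine ⟨.tensor (φ.relabel fun x => 2 * x) (ψ.relabel fun x => 2 * x + 1),
      PreStructure.interleave s t, ?_⟩
    rw [PreStructure.eval, PreStructure.eval_relabel_even, PreStructure.eval_relabel_odd, hφ, hψ]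
    rfl
  inv_mem' := by
    rintro _ ⟨φ, s, hφ⟩
    exact ⟨.inv φ, s, by rw [PreStructure.eval, hφ]; rfl⟩

theorem strictMono_subtype : StrictMono N.grSubgroup.subtype := fun _ _ h => h

theorem exists_map_eq_eval (φ : Formula L) (s : ℕ → N.carrier) :
    ∃ a : Gamma N.grSubgroup, Gamma.map N.grSubgroup.subtype a = N.eval φ s := by
  cases h : N.eval φ s with
  | zero => exact ⟨.zero, rfl⟩
  | infty => exact ⟨.infty, rfl⟩
  | val g => exact ⟨.val ⟨g, φ, s, h⟩, rfl⟩

theorem exists_map_eq_relMap {n : ℕ} (P : L.Relations n) (a : Fin n → N.carrier) :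
    ∃ b : Gamma N.grSubgroup, Gamma.map N.grSubgroup.subtype b = N.relMap P a := by
  obtain ⟨b, hb⟩ := N.exists_map_eq_eval (.rel P fun i => .var i)
    (fun x => if hx : x < n then a ⟨x, hx⟩ else Classical.arbitrary _)
  refine ⟨b, hb.trans ?_⟩
  simp [PreStructure.eval, PreStructure.termValue]

/-- The pre-structure `N` with its group replaced by the group of the truth values of formulas. -/
noncomputable abbrev preCore : PreStructure.{u, v, w} L where
  carrier := N.carrier
  group := N.grSubgroup
  funMap f a := N.funMap f a
  relMap P a := (N.exists_map_eq_relMap P a).choose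

theorem map_preCore_relMap {n : ℕ} (P : L.Relations n) (a : Fin n → N.carrier) :
    Gamma.map N.grSubgroup.subtype (N.preCore.relMap P a) = N.relMap P a :=
  (N.exists_map_eq_relMap P a).choose_spec

theorem preCore_termValue (t : L.Term ℕ) (s : ℕ → N.carrier) :
    N.preCore.termValue s t = N.termValue s t := by
  induction t with
  | var x => rfl
  | func f ts ih => simp only [PreStructure.termValue, ih]

/-- The supremum in `N` is the value of `∃ x φ`, hence already lies over the subgroup, and the
inclusion reflects it. The hypothesis `h` is the induction hypothesis of `map_preCore_eval`. -/
theorem isLUB_preCore {φ : Formula L}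
    (h : ∀ s, Gamma.map N.grSubgroup.subtype (N.preCore.eval φ s) = N.eval φ s)
    {x : ℕ} {s : ℕ → N.carrier} {a : Gamma N.grSubgroup}
    (ha : Gamma.map N.grSubgroup.subtype a = N.eval (.ex x φ) s) :
    IsLUB (Set.range fun b : N.carrier => N.preCore.eval φ (Function.update s x b)) a := by
  refine Gamma.isLUB_of_map N.strictMono_subtype ?_
  simp only [h, ha]
  exact N.isLUB_eval φ x s

theorem isGLB_preCore {φ : Formula L}
    (h : ∀ s, Gamma.map N.grSubgroup.subtype (N.preCore.eval φ s) = N.eval φ s)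
    {x : ℕ} {s : ℕ → N.carrier} {a : Gamma N.grSubgroup}
    (ha : Gamma.map N.grSubgroup.subtype a = N.eval (.all x φ) s) :
    IsGLB (Set.range fun b : N.carrier => N.preCore.eval φ (Function.update s x b)) a := by
  refine Gamma.isGLB_of_map N.strictMono_subtype ?_
  simp only [h, ha]
  exact N.isGLB_eval φ x s

theorem map_preCore_eval (φ : Formula L) (s : ℕ → N.carrier) :
    Gamma.map N.grSubgroup.subtype (N.preCore.eval φ s) = N.eval φ s := by
  induction φ generalizing s with
  | bot => rfl
  | one => rfl
  | rel P ts =>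
    simp only [PreStructure.eval, preCore_termValue]
    exact N.map_preCore_relMap P _
  | and φ ψ h₁ h₂ =>
    rw [PreStructure.eval, PreStructure.eval, Gamma.map_min N.strictMono_subtype, h₁, h₂]
  | imp φ ψ h₁ h₂ =>
    rw [PreStructure.eval, PreStructure.eval, Gamma.map_imp N.strictMono_subtype, h₁, h₂]
  | tensor φ ψ h₁ h₂ =>
    rw [PreStructure.eval, PreStructure.eval, Gamma.map_mul, h₁, h₂]
  | inv φ h => rw [PreStructure.eval, PreStructure.eval, Gamma.map_inv, h]
  | all x φ h =>
    obtain ⟨a, ha⟩ := N.exists_map_eq_eval (.all x φ) s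
    rw [← ha]
    exact congrArg _ (Gamma.inf_eq (N.isGLB_preCore h ha))
  | ex x φ h =>
    obtain ⟨a, ha⟩ := N.exists_map_eq_eval (.ex x φ) s
    rw [← ha]
    exact congrArg _ (Gamma.sup_eq (N.isLUB_preCore h ha))

/-- The structure `N` with its group replaced by the group of the truth values of formulas. -/
noncomputable abbrev core : Structure.{u, v, w} L where
  toPreStructure := N.preCore
  safe φ x s :=
    ⟨(N.exists_map_eq_eval (.ex x φ) s).imp fun _ => N.isLUB_preCore (N.map_preCore_eval φ),
      (N.exists_map_eq_eval (.all x φ) s).imp fun _ => N.isGLB_preCore (N.map_preCore_eval φ)⟩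

theorem isExhaustive_core : N.core.IsExhaustive := by
  refine Set.eq_univ_of_forall ?_
  rintro ⟨g, φ, s, h⟩
  refine ⟨φ, s, Gamma.map_injective N.strictMono_subtype ?_⟩
  rw [N.map_preCore_eval, h]
  rfl

theorem map_core_dist (e : L.Relations 2) (a b : N.carrier) :
    Gamma.map N.grSubgroup.subtype (N.core.dist e a b) = N.dist e a b := by
  rw [dist, Gamma.map_inv, N.map_preCore_relMap, dist]

theorem core_eval_eq_infty {φ : Formula L} {s : ℕ → N.carrier} :
    N.core.eval φ s = Gamma.infty ↔ N.eval φ s = Gamma.infty := by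
  rw [← (Gamma.map_injective N.strictMono_subtype).eq_iff, N.map_preCore_eval]
  rfl

variable {N}

theorem IsUltrametric.core {e : L.Relations 2} (h : N.IsUltrametric e) :
    N.core.IsUltrametric e := by
  refine ⟨fun a b => ?_, fun a b => ?_, fun a b c => ?_⟩
  · rw [← h.1, ← N.map_core_dist, ← (Gamma.map_injective N.strictMono_subtype).eq_iff]
    rfl
  · apply Gamma.map_injective N.strictMono_subtype
    rw [N.map_core_dist, N.map_core_dist, h.2.1]
  · have := h.2.2 a b c
    rw [le_max_iff] at this ⊢
    simpa only [← N.map_core_dist, Gamma.map_le_map N.strictMono_subtype] using this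

end Structure

/-! ### Maps over `M` and the amalgam -/

section Amalgamation

variable {L : FirstOrder.Language.{u, v}} {A : Structure.{u, v, w₁} L}
  {B : Structure.{u, v, w₂} L} {M : Structure.{u, v, w₃} L} {e : L.Relations 2}

theorem ElementaryEmbedding.eval_eq_infty (j : ElementaryEmbedding M A) {φ : Formula L}
    {s : ℕ → M.carrier} : A.eval φ (j.toFun ∘ s) = Gamma.infty ↔ M.eval φ s = Gamma.infty := by
  rw [← j.map_eval]
  cases M.eval φ s <;> simp [Gamma.map]

/-- Every formula true in `A` can be made true in `B` by a map over `M`. -/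
theorem exists_map_eval_eq_infty (hAe : A.IsUltrametric e) (hBe : B.IsUltrametric e)
    (j : ElementaryEmbedding M A) (k : ElementaryEmbedding M B) {φ : Formula L}
    {s : ℕ → A.carrier} (hφ : A.eval φ s = Gamma.infty) :
    ∃ h : A.carrier → B.carrier, h ∘ j.toFun = k.toFun ∧ B.eval φ (h ∘ s) = Gamma.infty := by
  classical
  have hm : ∀ x, ∃ m, s x ∈ Set.range j.toFun → j.toFun m = s x := fun x => by
    by_cases hx : s x ∈ Set.range j.toFun
    · exact hx.imp fun m hm _ => hm
    · exact ⟨Classical.arbitrary _, fun h => absurd h hx⟩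
  choose m hm using hm
  let n := φ.bound
  -- The variables to be quantified out; every other variable keeps a parameter from `M`.
  let l := (List.range n).filter fun x => s x ∉ Set.range j.toFun
  let p := ((List.range n).product (List.range n)).filter fun q => s q.1 = s q.2
  have hl : ∀ x, x ∈ l ↔ x < n ∧ s x ∉ Set.range j.toFun := fun x => by simp [l]
  have hp : ∀ x y, (x, y) ∈ p ↔ (x < n ∧ y < n) ∧ s x = s y := fun x y => by
    simp [p, List.product]
  -- The added equalities force any witness `t` to identify variables that `s` identifies, so that
  -- `s x ↦ t x` is well defined.
  let χ : Formula L := .and φ (.eqList e p)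
  have hA : A.eval (χ.exList l) (j.toFun ∘ m) = Gamma.infty := by
    refine A.eval_exList.2 ⟨fun x => if x ∈ l then s x else j.toFun (m x), fun x hx => by simp [hx],
      ?_⟩
    have hs : ∀ x < n, (if x ∈ l then s x else j.toFun (m x)) = s x := fun x hx => by
      split_ifs with h
      · rfl
      · exact hm x (by_contra fun h' => h ((hl x).2 ⟨hx, h'⟩))
    refine Gamma.min_eq_infty.2 ⟨(A.eval_congr hs).trans hφ, A.eval_eqList.2 ?_⟩
    rintro ⟨x, y⟩ hxy
    obtain ⟨⟨hx, hy⟩, hxy⟩ := (hp x y).1 hxy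
    rw [hAe.relMap_eq_infty]
    exact (hs x hx).trans (hxy.trans (hs y hy).symm)
  -- All parameters are images of `m`, so the truth of the formula descends to `M` along `j` and
  -- ascends to `B` along `k`.
  obtain ⟨t, ht, htχ⟩ := B.eval_exList.1 (k.eval_eq_infty.2 (j.eval_eq_infty.1 hA))
  obtain ⟨htφ, hteq⟩ := Gamma.min_eq_infty.1 htχ
  have hts : ∀ x < n, ∀ y < n, s x = s y → t x = t y := fun x hx y hy hxy =>
    hBe.relMap_eq_infty.1 (B.eval_eqList.1 hteq (x, y) ((hp x y).2 ⟨⟨hx, hy⟩, hxy⟩))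
  have htm : ∀ x < n, ∀ c, s x = j.toFun c → t x = k.toFun c := fun x hx c hc => by
    rw [ht x fun h => ((hl x).1 h).2 ⟨c, hc.symm⟩]
    exact congrArg k.toFun (j.injective ((hm x ⟨c, hc.symm⟩).trans hc))
  -- The prescriptions `s x ↦ t x` for `x < n` and `j c ↦ k c` are compatible by `hts`, `htm` and
  -- injectivity of `j`; elsewhere the map is arbitrary.
  have hh : ∀ a, ∃ b, (∀ x < n, s x = a → t x = b) ∧ ∀ c, j.toFun c = a → k.toFun c = b := by
    intro a
    by_cases h₁ : ∃ x < n, s x = a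
    · obtain ⟨x, hx, rfl⟩ := h₁
      exact ⟨t x, fun y hy hyx => hts y hy x hx hyx, fun c hc => (htm x hx c hc.symm).symm⟩
    · by_cases h₂ : ∃ c, j.toFun c = a
      · obtain ⟨c, rfl⟩ := h₂
        exact ⟨k.toFun c, fun x hx hxc => htm x hx c hxc,
          fun d hd => congrArg k.toFun (j.injective hd)⟩
      · exact ⟨Classical.arbitrary _, fun x hx hxa => absurd ⟨x, hx, hxa⟩ h₁,
          fun c hc => absurd ⟨c, hc⟩ h₂⟩
  choose h hh using hh
  refine ⟨h, funext fun c => ((hh _).2 c rfl).symm, ?_⟩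
  rw [← htφ]
  exact B.eval_congr fun x hx => ((hh _).1 x hx rfl).symm

/-- An ultrafilter on the maps `A → B` containing the maps over `M` that make a given formula
true in `A` true in `B`. -/
theorem exists_ultrafilter (hAe : A.IsUltrametric e) (hBe : B.IsUltrametric e)
    (j : ElementaryEmbedding M A) (k : ElementaryEmbedding M B) :
    ∃ U : Ultrafilter (ULift.{max u v} (A.carrier → B.carrier)),
      (∀ᶠ h in U, ULift.down h ∘ j.toFun = k.toFun) ∧
      ∀ (φ : Formula L) (s : ℕ → A.carrier), A.eval φ s = Gamma.infty →
        ∀ᶠ h in U, B.eval φ (ULift.down h ∘ s) = Gamma.infty := by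
  let T := {q : Formula L × (ℕ → A.carrier) // A.eval q.1 q.2 = Gamma.infty}
  let X : T → Set (ULift.{max u v} (A.carrier → B.carrier)) := fun q =>
    {h | h.down ∘ j.toFun = k.toFun ∧ B.eval q.1.1 (h.down ∘ q.1.2) = Gamma.infty}
  have hT : ∀ s : ℕ → A.carrier, A.eval (.inv .bot) s = Gamma.infty := fun _ => rfl
  have : Nonempty T := ⟨⟨(.inv .bot, fun _ => Classical.arbitrary _), hT _⟩⟩
  have hdir : Directed (· ≥ ·) fun q => Filter.principal (X q) := by
    rintro ⟨⟨φ, s⟩, hφ⟩ ⟨⟨ψ, t⟩, hψ⟩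
    -- Conjunction on interleaved assignments yields a set inside both given ones, so nonemptiness
    -- of each single set suffices.
    let χ : Formula L := .and (φ.relabel fun x => 2 * x) (ψ.relabel fun x => 2 * x + 1)
    refine ⟨⟨(χ, PreStructure.interleave s t), ?_⟩, ?_, ?_⟩
    · exact Gamma.min_eq_infty.2 ⟨(A.eval_relabel_even _ _ _).trans hφ,
        (A.eval_relabel_odd _ _ _).trans hψ⟩
    all_goals
      refine Filter.principal_mono.2 fun h hh => ⟨hh.1, ?_⟩
      have h₁ := hh.2
      simp only [χ, PreStructure.comp_interleave, PreStructure.eval, Gamma.min_eq_infty,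
        PreStructure.eval_relabel_even, PreStructure.eval_relabel_odd] at h₁
    · exact h₁.1
    · exact h₁.2
  have hne : (⨅ q, Filter.principal (X q)).NeBot := by
    refine Filter.iInf_neBot_of_directed' hdir fun q => Filter.principal_neBot_iff.2 ?_
    obtain ⟨h, hh⟩ := exists_map_eval_eq_infty hAe hBe j k q.2
    exact ⟨⟨h⟩, hh⟩
  have hU : ∀ q, ∀ᶠ h in (Ultrafilter.of (⨅ q, Filter.principal (X q)) : Filter _), h ∈ X q :=
    fun q => Ultrafilter.of_le _ (Filter.mem_iInf_of_mem q (Filter.mem_principal_self _))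
  refine ⟨Ultrafilter.of (⨅ q, Filter.principal (X q)), ?_, fun φ s hφ => ?_⟩
  · exact (hU (Classical.arbitrary T)).mono fun h hh => hh.1
  · exact (hU ⟨(φ, s), hφ⟩).mono fun h hh => hh.2

/-- This serves both sides: a varying `h` gives the evaluation map on `A`, and the constant identity
gives the diagonal of `B`. -/
theorem preservesTruth_ultrapower {I : Type w} {U : Ultrafilter I} {h : I → A.carrier → B.carrier}
    (hh : ∀ (φ : Formula L) (s : ℕ → A.carrier), A.eval φ s = Gamma.infty →
      ∀ᶠ i in U, B.eval φ (h i ∘ s) = Gamma.infty) :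
    PreservesTruth A (B.ultrapower U).core
      fun a => ((fun i => h i a : I → B.carrier) : Filter.Germ (U : Filter I) B.carrier) := by
  intro φ s hφ
  refine (B.ultrapower U).core_eval_eq_infty.2 ?_
  refine (Structure.ultrapower_eval φ fun x i => h i (s x)).trans ?_
  rw [← Gamma.ofFamily_infty (U := U)]
  exact Gamma.ofFamily_congr (hh φ s hφ)

end Amalgamation

end AddGodel

theorem mainTheorem5 {L : FirstOrder.Language.{u, v}} (e : L.Relations 2)
    (A : AddGodel.Structure.{u, v, w₁} L) (B : AddGodel.Structure.{u, v, w₂} L)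
    (M : AddGodel.Structure.{u, v, w₃} L)
    (hA : A.IsExhaustive) (hB : B.IsExhaustive) (hM : M.IsExhaustive)
    (hAe : A.IsUltrametric e) (hBe : B.IsUltrametric e) (hMe : M.IsUltrametric e)
    (j : AddGodel.ElementaryEmbedding M A) (k : AddGodel.ElementaryEmbedding M B) :
    ∃ N : AddGodel.Structure.{u, v, max u v w₁ w₂} L,
      N.IsExhaustive ∧ N.IsUltrametric e ∧
      ∃ (j₁ : AddGodel.ElementaryEmbedding A N) (k₁ : AddGodel.ElementaryEmbedding B N),
        j₁.toFun ∘ j.toFun = k₁.toFun ∘ k.toFun := by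
  -- The `ULift` in the index type only places the ultrapower in the universe required of `N`.
  obtain ⟨U, hU, hUφ⟩ := AddGodel.exists_ultrafilter hAe hBe j k
  have hNe := (hBe.ultrapower (U := U)).core
  obtain ⟨j₁, hj₁⟩ := (AddGodel.preservesTruth_ultrapower (h := fun i => i.down)
    hUφ).exists_elementaryEmbedding hA hAe hNe
  obtain ⟨k₁, hk₁⟩ := (AddGodel.preservesTruth_ultrapower (A := B) (B := B) (U := U)
    (h := fun _ b => b)
    fun φ s hφ => Filter.Eventually.of_forall fun _ => hφ).exists_elementaryEmbedding hB hBe hNe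
  refine ⟨(B.ultrapower U).core, (B.ultrapower U).isExhaustive_core, hNe, j₁, k₁, ?_⟩
  rw [hj₁, hk₁]
  -- At `j m` the evaluation germ `h ↦ h (j m)` is almost everywhere the constant `k m`.
  exact funext fun m => Filter.Germ.coe_eq.2 (hU.mono fun h hh => congrFun hh m)
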